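/- Let $H$ be a real Hilbert space. A set-valued operator $A\colon H\rightrightarrows H$ is monotone if $\langle v_1-v_2,x_1-x_2\rangle\ge 0$ whenever $v_1\in A(x_1)$ and $v_2\in A(x_2)$, and maximally monotone if, in addition, its graph is not properly contained in the graph of another monotone operator. For $v\in A(x)$ and $\tau>0$, let $\Delta_\tau\colon H\rightrightarrows H$ be the difference quotient $\Delta_\tau(h):=\tau^{-1}\bigl(A(x+\tau h)-v\bigr)$. The operator $A$ is proto-differentiable at $x$ relative to $v\in A(x)$ if the graphs of $\Delta_\tau$ converge in the sense of Painlevé–Kuratowski as $\tau\searrow 0$, with respect to the norm topology of $H\times H$, i.e. if their outer limit (the set of all limits of sequences $p_n\in\operatorname{graph}\Delta_{\tau_n}$ with $\tau_n>0$, $\tau_n\to0$) equals their inner limit (the set of all $p$ such that for every sequence $\tau_n>0$, $\tau_n\to 0$, there are $p_n\to p$ with $p_n\in\operatorname{graph}\Delta_{\tau_n}$ for all large $n$). In this case the proto-derivative $D_pA(x\mid v)\colon H\rightrightarrows H$ is the operator whose graph is this limit. **Theorem.** Let $B\colon H\rightrightarrows H$ be maximally monotone. Then its resolvent $J_B:=(\mathrm{Id}+B)^{-1}$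 is a single-valued map defined on all of $H$. Moreover, for every $y\in H$ and $x:=J_B(y)$, the following are equivalent: 1. $B$ is proto-differentiable at $x$ relative to $y-x\in B(x)$, and the proto-derivative $D_pB(x\mid y-x)\colon H\rightrightarrows H$ is maximally monotone; 2. $J_B$ is directionally differentiable at $y$, i.e. the limit $$J_B'(y;h)=\lim_{\tau\searrow0}\frac{J_B(y+\tau h)-J_B(y)}{\tau}$$ exists (in norm) for all $h\in H$. -/

import Mathlib

open Filter Topology

/-! Set-valued operators `H ⇉ H` are functions `H → Set H`; inclusion of graphs is the pointwise
order `≤` on `H → Set H`. -/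

namespace SetValued

variable {H : Type*} [NormedAddCommGroup H] [InnerProductSpace ℝ H]

/-- The graph of a set-valued operator. -/
def graph (A : H → Set H) : Set (H × H) := {p | p.2 ∈ A p.1}

/-- Monotonicity of a set-valued operator on a real inner product space. -/
def IsMonotone (A : H → Set H) : Prop :=
  ∀ x₁ x₂ v₁ v₂ : H, v₁ ∈ A x₁ → v₂ ∈ A x₂ → 0 ≤ inner ℝ (v₁ - v₂) (x₁ - x₂)

/-- Maximal monotonicity: `A` is monotone and its graph is not properly contained in the graph of
another monotone operator. -/
def IsMaximallyMonotone (A : H → Set H) : Prop := Maximal IsMonotone A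

/-- The set-valued inverse of a set-valued operator. -/
def inv (A : H → Set H) : H → Set H := fun y => {x | y ∈ A x}

/-- The operator `Id + A`. -/
def idAdd (A : H → Set H) : H → Set H := fun x => {y | ∃ v ∈ A x, y = x + v}

/-- The value at `y` of the resolvent `J_A = (Id + A)⁻¹` as a point: an element of
`(Id + A)⁻¹ y`, which is arbitrary if that set is empty or has several elements. -/
noncomputable def resolvent (A : H → Set H) (y : H) : H :=
  Classical.epsilon fun x => x ∈ inv (idAdd A) y

/-- The first-order difference quotient `h ↦ (A (x + τ h) - v) / τ` of `A` at `x` relative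
to `v`. -/
def diffQuot (A : H → Set H) (x v : H) (τ : ℝ) : H → Set H :=
  fun h => {k | ∃ w ∈ A (x + τ • h), k = τ⁻¹ • (w - v)}

/-- The (Painlevé-Kuratowski) outer limit of a family of sets `S τ` as `τ ↘ 0`, in the given
topology (the norm topology when `X` is normed). -/
def outerLimit {X : Type*} [TopologicalSpace X] (S : ℝ → Set X) : Set X :=
  {p | ∃ (τ : ℕ → ℝ) (u : ℕ → X), (∀ n, 0 < τ n) ∧ Tendsto τ atTop (𝓝 0) ∧
    (∀ n, u n ∈ S (τ n)) ∧ Tendsto u atTop (𝓝 p)}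

/-- The (Painlevé-Kuratowski) inner limit of a family of sets `S τ` as `τ ↘ 0`. -/
def innerLimit {X : Type*} [TopologicalSpace X] (S : ℝ → Set X) : Set X :=
  {p | ∀ τ : ℕ → ℝ, (∀ n, 0 < τ n) → Tendsto τ atTop (𝓝 0) →
    ∃ u : ℕ → X, (∀ᶠ n in atTop, u n ∈ S (τ n)) ∧ Tendsto u atTop (𝓝 p)}

/-- `A` is proto-differentiable at `x` relative to `v ∈ A x`: the graphs of the difference
quotients converge, i.e. their outer and inner limits as `τ ↘ 0` coincide. -/
def IsProtoDifferentiableAt (A : H → Set H) (x v : H) : Prop :=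
  v ∈ A x ∧
    outerLimit (fun τ => graph (diffQuot A x v τ)) = innerLimit (fun τ => graph (diffQuot A x v τ))

/-- The proto-derivative of `A` at `x` relative to `v`: the operator whose graph is the limit of
the graphs of the difference quotients (the outer limit, which is the limit as soon as `A` is
proto-differentiable at `x` relative to `v`). -/
def protoDeriv (A : H → Set H) (x v : H) : H → Set H :=
  fun h => {k | (h, k) ∈ outerLimit (fun τ => graph (diffQuot A x v τ))}

/-- `f` is directionally differentiable at `y`: the limit of `(f (y + τ h) - f y) / τ` as `τ ↘ 0`
exists in norm for every direction `h`. -/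
def IsDirectionallyDifferentiableAt (f : H → H) (y : H) : Prop :=
  ∀ h : H, ∃ d : H, Tendsto (fun τ : ℝ => τ⁻¹ • (f (y + τ • h) - f y)) (𝓝[>] 0) (𝓝 d)

end SetValued

/-! Minty's theorem makes maximal monotonicity of `A` a solvability statement: the monotone operator
`A` is maximal iff every `z` is of the form `x + v` with `v ∈ A x`. In the coordinates
`(x, v) ↦ (x + v, x)` the graph of `B` is therefore the graph of the nonexpansive map `J_B`, and the
graphs of the difference quotients of `B` are those of the difference quotients of `J_B`. For a
family of maps with a common Lipschitz constant, convergence of the graphs to a set lying over every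
point is the same as pointwise convergence. Finally, the monotonicity of the proto-derivative comes
for free, since it passes to inner limits, and by Minty's theorem its maximality is the remaining
condition that the limit set lies over every point.

Minty's theorem itself is proved by minimising `F_A (x, u) + (‖x‖² + ‖u‖²) / 2`, where the
Fitzpatrick function `F_A` of `A` is a convex majorant of `⟪x, u⟫`. The variational inequality at a
minimiser `(x, u)` shows that adding `(-u, -x)` to the graph of `A` preserves monotonicity, so that
`-x ∈ A (-u)`; applied to this very point it gives `u = -x`, so `0 ∈ x + A x`. -/

namespace SetValued

section ProxObjective

variable {E : Type*} [NormedAddCommGroup E] [InnerProductSpace ℝ E] {C : Set (E × ℝ)}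

/-- The functional `(x, r) ↦ r + ‖x‖² / 2`. Minimising it over the epigraph of a convex function
computes the proximal point of that function at the origin. -/
noncomputable def proxObjective (p : E × ℝ) : ℝ := p.2 + ‖p.1‖ ^ 2 / 2

theorem proxObjective_add_smul_sub (p q : E × ℝ) (t : ℝ) :
    proxObjective (p + t • (q - p)) = proxObjective p +
      t * (inner ℝ p.1 (q.1 - p.1) + (q.2 - p.2)) + t ^ 2 * (‖q.1 - p.1‖ ^ 2 / 2) := by
  simp only [proxObjective, Prod.fst_add, Prod.snd_add, Prod.smul_fst, Prod.smul_snd, Prod.fst_sub,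
    Prod.snd_sub, smul_eq_mul, norm_add_sq_real, real_inner_smul_right, norm_smul, mul_pow,
    Real.norm_eq_abs, sq_abs]
  ring

theorem norm_fst_sub_sq_le_of_le_proxObjective (hC : Convex ℝ C) {m : ℝ}
    (hm : ∀ p ∈ C, m ≤ proxObjective p) {p q : E × ℝ} (hp : p ∈ C) (hq : q ∈ C) :
    ‖q.1 - p.1‖ ^ 2 ≤ 4 * (proxObjective p - m) + 4 * (proxObjective q - m) := by
  have hmid := hm _ (hC.add_smul_sub_mem hp hq (t := 1 / 2) ⟨by norm_num, by norm_num⟩)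
  have hend := proxObjective_add_smul_sub p q 1
  rw [proxObjective_add_smul_sub] at hmid
  rw [one_smul, add_sub_cancel] at hend
  linarith

theorem exists_isMinOn_proxObjective [CompleteSpace E] (hne : C.Nonempty) (hconv : Convex ℝ C)
    (hcl : IsClosed C) (hbdd : BddBelow (proxObjective '' C)) :
    ∃ p ∈ C, IsMinOn proxObjective C p := by
  set m := sInf (proxObjective '' C)
  have hm : ∀ p ∈ C, m ≤ proxObjective p := fun p hp => csInf_le hbdd ⟨p, hp, rfl⟩
  obtain ⟨v, hv_anti, hv, hvC⟩ := exists_seq_tendsto_sInf (hne.image _) hbdd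
  choose u huC huv using hvC
  have hcauchy : CauchySeq fun n => (u n).1 := by
    refine cauchySeq_of_le_tendsto_0' (fun n => √(8 * (v n - m))) (fun n k hnk => ?_) ?_
    · have hsq := norm_fst_sub_sq_le_of_le_proxObjective hconv hm (huC k) (huC n)
      rw [huv, huv] at hsq
      rw [dist_eq_norm]
      exact Real.le_sqrt_of_sq_le (by linarith [hv_anti hnk])
    · have hlim := ((hv.sub_const m).const_mul 8).sqrt
      rwa [sub_self, mul_zero, Real.sqrt_zero] at hlim
  obtain ⟨x, hx⟩ := cauchySeq_tendsto_of_complete hcauchy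
  have hr : Tendsto (fun n => (u n).2) atTop (𝓝 (m - ‖x‖ ^ 2 / 2)) :=
    (hv.sub ((hx.norm.pow 2).div_const 2)).congr fun n => by
      rw [← huv, proxObjective, add_sub_cancel_right]
  refine ⟨(x, m - ‖x‖ ^ 2 / 2), hcl.mem_of_tendsto (hx.prodMk_nhds hr) (.of_forall huC),
    isMinOn_iff.2 fun q hq => ?_⟩
  simpa [proxObjective] using hm q hq

theorem inner_add_nonneg_of_isMinOn_proxObjective (hC : Convex ℝ C) {p q : E × ℝ} (hp : p ∈ C)
    (hmin : IsMinOn proxObjective C p) (hq : q ∈ C) :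
    0 ≤ inner ℝ p.1 (q.1 - p.1) + (q.2 - p.2) := by
  set a := inner ℝ p.1 (q.1 - p.1) + (q.2 - p.2) with ha
  have hslope : ∀ t ∈ Set.Ioc (0 : ℝ) 1, 0 ≤ a + t * (‖q.1 - p.1‖ ^ 2 / 2) := by
    intro t ht
    have h := isMinOn_iff.1 hmin _ (hC.add_smul_sub_mem hp hq ⟨ht.1.le, ht.2⟩)
    rw [proxObjective_add_smul_sub, ← ha] at h
    exact nonneg_of_mul_nonneg_right (by linarith) ht.1
  have hlim : Tendsto (fun t : ℝ => a + t * (‖q.1 - p.1‖ ^ 2 / 2)) (𝓝[>] 0) (𝓝 a) :=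
    (Continuous.tendsto' (by fun_prop) _ _ (by simp)).mono_left nhdsWithin_le_nhds
  exact ge_of_tendsto hlim (Filter.mem_of_superset (Ioc_mem_nhdsGT zero_lt_one) hslope)

end ProxObjective

theorem mem_inv_idAdd {H : Type*} [NormedAddCommGroup H] {A : H → Set H} {x z : H} :
    x ∈ inv (idAdd A) z ↔ z - x ∈ A x := by
  constructor
  · rintro ⟨v, hv, rfl⟩
    rwa [add_sub_cancel_left]
  · exact fun h => ⟨_, h, (add_sub_cancel x z).symm⟩

theorem mem_diffQuot_iff {H : Type*} [NormedAddCommGroup H] [InnerProductSpace ℝ H]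
    {A : H → Set H} {x v h k : H} {τ : ℝ} (hτ : τ ≠ 0) :
    k ∈ diffQuot A x v τ h ↔ v + τ • k ∈ A (x + τ • h) := by
  constructor
  · rintro ⟨w, hw, rfl⟩
    rwa [smul_inv_smul₀ hτ, add_sub_cancel]
  · exact fun hk => ⟨_, hk, by rw [add_sub_cancel_left, inv_smul_smul₀ hτ]⟩

section Minty

variable {H : Type*} [NormedAddCommGroup H] [InnerProductSpace ℝ H] {A : H → Set H}

theorem IsMaximallyMonotone.mem_of_forall_inner_nonneg (hA : IsMaximallyMonotone A) {x v : H}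
    (h : ∀ a b, b ∈ A a → 0 ≤ inner ℝ (b - v) (a - x)) : v ∈ A x := by
  have hmono : IsMonotone fun a => A a ∪ {b | a = x ∧ b = v} := by
    rintro a₁ a₂ b₁ b₂ (h₁ | ⟨rfl, rfl⟩) (h₂ | ⟨rfl, rfl⟩)
    · exact hA.prop _ _ _ _ h₁ h₂
    · exact h _ _ h₁
    · rw [← neg_sub b₂, ← neg_sub a₂, inner_neg_neg]
      exact h _ _ h₂
    · rw [sub_self, inner_zero_left]
  exact hA.2 hmono (fun _ _ => Or.inl) x (Or.inr ⟨rfl, rfl⟩)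

theorem IsMaximallyMonotone.exists_mem (hA : IsMaximallyMonotone A) : ∃ a b, b ∈ A a := by
  by_contra! h
  exact h 0 0 (hA.mem_of_forall_inner_nonneg fun a b hb => absurd hb (h a b))

/-- The epigraph of the Fitzpatrick function `(x, u) ↦ sup {⟪b, x⟫ + ⟪a, u⟫ - ⟪a, b⟫ | b ∈ A a}`
of `A`, on the Hilbert space `H × H`. The epigraph is used in place of the function, which may take
infinite values. -/
def fitzpatrickEpigraph (A : H → Set H) : Set (WithLp 2 (H × H) × ℝ) :=
  {p | ∀ a b, b ∈ A a → inner ℝ (WithLp.toLp 2 (b, a)) p.1 - inner ℝ a b ≤ p.2}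

theorem convex_fitzpatrickEpigraph (A : H → Set H) : Convex ℝ (fitzpatrickEpigraph A) := by
  intro p hp q hq s t hs ht hst a b hb
  calc inner ℝ (WithLp.toLp 2 (b, a)) (s • p.1 + t • q.1) - inner ℝ a b
      = s * (inner ℝ (WithLp.toLp 2 (b, a)) p.1 - inner ℝ a b) +
          t * (inner ℝ (WithLp.toLp 2 (b, a)) q.1 - inner ℝ a b) := by
        rw [inner_add_right, real_inner_smul_right, real_inner_smul_right]
        linear_combination inner ℝ a b * hst
    _ ≤ s * p.2 + t * q.2 := by
        gcongr
        exacts [hp a b hb, hq a b hb]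

theorem isClosed_fitzpatrickEpigraph (A : H → Set H) : IsClosed (fitzpatrickEpigraph A) := by
  simp only [fitzpatrickEpigraph, Set.ofPred_forall]
  exact isClosed_iInter fun a => isClosed_iInter fun b => isClosed_iInter fun _ =>
    isClosed_le (by fun_prop) continuous_snd

theorem mem_fitzpatrickEpigraph_iff {p : WithLp 2 (H × H) × ℝ} :
    p ∈ fitzpatrickEpigraph A ↔ ∀ a b, b ∈ A a →
      inner ℝ p.1.fst p.1.snd - p.2 ≤ inner ℝ (b - p.1.snd) (a - p.1.fst) := by
  refine forall₃_congr fun a b _ => ?_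
  have hinner : inner ℝ (WithLp.toLp 2 (b, a)) p.1 = inner ℝ b p.1.fst + inner ℝ a p.1.snd :=
    WithLp.prod_inner_apply _ _
  rw [hinner, inner_sub_left, inner_sub_right, inner_sub_right, real_inner_comm a b,
    real_inner_comm a p.1.snd, real_inner_comm p.1.fst p.1.snd]
  constructor <;> intro h <;> linarith

theorem IsMonotone.mem_fitzpatrickEpigraph (hA : IsMonotone A) {a b : H} (hb : b ∈ A a) :
    (WithLp.toLp 2 (a, b), inner ℝ a b) ∈ fitzpatrickEpigraph A :=
  mem_fitzpatrickEpigraph_iff.2 fun a' b' hb' => by simpa using hA _ _ _ _ hb' hb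

theorem IsMaximallyMonotone.inner_le_of_mem_fitzpatrickEpigraph (hA : IsMaximallyMonotone A)
    {p : WithLp 2 (H × H) × ℝ} (hp : p ∈ fitzpatrickEpigraph A) :
    inner ℝ p.1.fst p.1.snd ≤ p.2 := by
  rw [mem_fitzpatrickEpigraph_iff] at hp
  by_contra! hlt
  have hmem : p.1.snd ∈ A p.1.fst :=
    hA.mem_of_forall_inner_nonneg fun a b hb => (sub_pos.2 hlt).le.trans (hp a b hb)
  have hle := hp _ _ hmem
  rw [sub_self, inner_zero_left] at hle
  linarith

theorem IsMaximallyMonotone.bddBelow_proxObjective_fitzpatrickEpigraph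
    (hA : IsMaximallyMonotone A) : BddBelow (proxObjective '' fitzpatrickEpigraph A) := by
  refine ⟨0, ?_⟩
  rintro _ ⟨p, hp, rfl⟩
  have hle := hA.inner_le_of_mem_fitzpatrickEpigraph hp
  have hsq := norm_add_sq_real p.1.fst p.1.snd
  rw [proxObjective, WithLp.prod_norm_sq_eq_of_L2]
  linarith [sq_nonneg ‖p.1.fst + p.1.snd‖]

theorem IsMaximallyMonotone.exists_norm_add_sq_le_inner [CompleteSpace H]
    (hA : IsMaximallyMonotone A) :
    ∃ x u : H, ∀ a b, b ∈ A a → ‖x + u‖ ^ 2 ≤ inner ℝ (b + x) (a + u) := by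
  obtain ⟨a₀, b₀, hab₀⟩ := hA.exists_mem
  obtain ⟨p, hp, hmin⟩ := exists_isMinOn_proxObjective ⟨_, hA.prop.mem_fitzpatrickEpigraph hab₀⟩
    (convex_fitzpatrickEpigraph A) (isClosed_fitzpatrickEpigraph A)
    hA.bddBelow_proxObjective_fitzpatrickEpigraph
  refine ⟨p.1.fst, p.1.snd, fun a b hb => ?_⟩
  have hle := hA.inner_le_of_mem_fitzpatrickEpigraph hp
  -- The Fitzpatrick function is at most `⟪a, b⟫` at `(a, b)`, so test the minimality of `p` there.
  have hvar := inner_add_nonneg_of_isMinOn_proxObjective (convex_fitzpatrickEpigraph A) hp hmin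
    (hA.prop.mem_fitzpatrickEpigraph hb)
  have hinner : inner ℝ p.1 (WithLp.toLp 2 (a, b)) = inner ℝ p.1.fst a + inner ℝ p.1.snd b :=
    WithLp.prod_inner_apply _ _
  rw [inner_sub_right, real_inner_self_eq_norm_sq, WithLp.prod_norm_sq_eq_of_L2, hinner] at hvar
  rw [norm_add_sq_real, inner_add_left, inner_add_right, inner_add_right, real_inner_comm a b,
    real_inner_comm p.1.snd b]
  linarith

theorem IsMaximallyMonotone.exists_neg_mem [CompleteSpace H] (hA : IsMaximallyMonotone A) :
    ∃ x, -x ∈ A x := by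
  obtain ⟨x, u, hxu⟩ := hA.exists_norm_add_sq_le_inner
  have hmem : -x ∈ A (-u) := hA.mem_of_forall_inner_nonneg fun a b hb => by
    simpa using (sq_nonneg _).trans (hxu a b hb)
  have hzero : x + u = 0 := by simpa using hxu _ _ hmem
  exact ⟨x, by rwa [neg_eq_of_add_eq_zero_left hzero] at hmem⟩

theorem IsMaximallyMonotone.translate (hA : IsMaximallyMonotone A) (z : H) :
    IsMaximallyMonotone fun x => {v | v + z ∈ A x} := by
  refine ⟨fun x₁ x₂ v₁ v₂ h₁ h₂ => ?_, fun C hC hle x v hv => ?_⟩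
  · simpa using hA.prop _ _ _ _ h₁ h₂
  · refine hA.mem_of_forall_inner_nonneg fun a b hb => ?_
    have h := hC a x (b - z) v (hle a (by simpa using hb)) hv
    rwa [sub_sub, add_comm z] at h

theorem IsMonotone.norm_sub_le (hA : IsMonotone A) {x₁ x₂ v₁ v₂ : H} (h₁ : v₁ ∈ A x₁)
    (h₂ : v₂ ∈ A x₂) : ‖x₁ - x₂‖ ≤ ‖(x₁ + v₁) - (x₂ + v₂)‖ := by
  have h := hA _ _ _ _ h₁ h₂
  rw [real_inner_comm] at h
  refine le_of_sq_le_sq ?_ (norm_nonneg _)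
  rw [add_sub_add_comm, norm_add_sq_real]
  linarith [sq_nonneg ‖v₁ - v₂‖]

theorem IsMonotone.eq_of_sub_mem (hA : IsMonotone A) {z x₁ x₂ : H} (h₁ : z - x₁ ∈ A x₁)
    (h₂ : z - x₂ ∈ A x₂) : x₁ = x₂ := by
  simpa [sub_eq_zero] using hA.norm_sub_le h₁ h₂

theorem isMaximallyMonotone_iff_forall_exists_sub_mem [CompleteSpace H] :
    IsMaximallyMonotone A ↔ IsMonotone A ∧ ∀ z, ∃ x, z - x ∈ A x := by
  refine ⟨fun hA => ⟨hA.prop, fun z => ?_⟩, fun ⟨hA, hsurj⟩ => ⟨hA, fun C hC hle x v hv => ?_⟩⟩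
  · obtain ⟨x, hx⟩ := (hA.translate z).exists_neg_mem
    exact ⟨x, by rwa [sub_eq_neg_add]⟩
  · obtain ⟨x', hx'⟩ := hsurj (x + v)
    have hxx' : x' = x := hC.eq_of_sub_mem (hle _ hx') (by rwa [add_sub_cancel_left])
    rwa [hxx', add_sub_cancel_left] at hx'

end Minty

section Resolvent

variable {H : Type*} [NormedAddCommGroup H] [InnerProductSpace ℝ H] [CompleteSpace H]
  {B : H → Set H}

theorem IsMaximallyMonotone.sub_resolvent_mem (hB : IsMaximallyMonotone B) (z : H) :
    z - resolvent B z ∈ B (resolvent B z) := by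
  obtain ⟨x, hx⟩ := (isMaximallyMonotone_iff_forall_exists_sub_mem.1 hB).2 z
  exact mem_inv_idAdd.1 (Classical.epsilon_spec (p := fun x => x ∈ inv (idAdd B) z)
    ⟨x, mem_inv_idAdd.2 hx⟩)

theorem IsMaximallyMonotone.mem_iff_resolvent_add_eq (hB : IsMaximallyMonotone B) {x v : H} :
    v ∈ B x ↔ resolvent B (x + v) = x := by
  have hres := hB.sub_resolvent_mem (x + v)
  constructor
  · exact fun hv => hB.prop.eq_of_sub_mem hres (by rwa [add_sub_cancel_left])
  · intro hx
    rwa [hx, add_sub_cancel_left] at hres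

theorem IsMaximallyMonotone.inv_idAdd_eq_singleton (hB : IsMaximallyMonotone B) (z : H) :
    inv (idAdd B) z = {resolvent B z} := by
  ext x
  rw [mem_inv_idAdd, hB.mem_iff_resolvent_add_eq, add_sub_cancel, Set.mem_singleton_iff, eq_comm]

theorem IsMaximallyMonotone.lipschitzWith_resolvent (hB : IsMaximallyMonotone B) :
    LipschitzWith 1 (resolvent B) :=
  LipschitzWith.mk_one fun z w => by
    simpa [dist_eq_norm] using
      hB.prop.norm_sub_le (hB.sub_resolvent_mem z) (hB.sub_resolvent_mem w)

end Resolvent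

section SetLimits

variable {X Y : Type*} [TopologicalSpace X] [TopologicalSpace Y]

theorem innerLimit_subset_outerLimit (S : ℝ → Set X) : innerLimit S ⊆ outerLimit S := by
  intro p hp
  obtain ⟨τ, -, hτ, hτ0⟩ := exists_seq_strictAnti_tendsto (0 : ℝ)
  obtain ⟨u, hu, hup⟩ := hp τ hτ hτ0
  obtain ⟨N, hN⟩ := eventually_atTop.1 hu
  exact ⟨fun n => τ (n + N), fun n => u (n + N), fun n => hτ _, (tendsto_add_atTop_iff_nat N).2 hτ0,
    fun n => hN _ (Nat.le_add_left N n), (tendsto_add_atTop_iff_nat N).2 hup⟩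

theorem mapsTo_outerLimit {f : X → Y} (hf : Continuous f) {S : ℝ → Set X} {T : ℝ → Set Y}
    (h : ∀ τ > 0, Set.MapsTo f (S τ) (T τ)) : Set.MapsTo f (outerLimit S) (outerLimit T) := by
  rintro p ⟨τ, u, hτ, hτ0, hu, hup⟩
  exact ⟨τ, f ∘ u, hτ, hτ0, fun n => h _ (hτ n) (hu n), (hf.tendsto p).comp hup⟩

theorem mapsTo_innerLimit {f : X → Y} (hf : Continuous f) {S : ℝ → Set X} {T : ℝ → Set Y}
    (h : ∀ τ > 0, Set.MapsTo f (S τ) (T τ)) : Set.MapsTo f (innerLimit S) (innerLimit T) := by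
  intro p hp τ hτ hτ0
  obtain ⟨u, hu, hup⟩ := hp τ hτ hτ0
  exact ⟨f ∘ u, hu.mono fun n hn => h _ (hτ n) hn, (hf.tendsto p).comp hup⟩

theorem outerLimit_eq_preimage (e : X ≃ₜ Y) {S : ℝ → Set X} {T : ℝ → Set Y}
    (h : ∀ τ > 0, S τ = e ⁻¹' T τ) : outerLimit S = e ⁻¹' outerLimit T := by
  refine Set.Subset.antisymm (mapsTo_outerLimit e.continuous fun τ hτ => (h τ hτ).subset) ?_
  have hsymm : Set.MapsTo e.symm (outerLimit T) (outerLimit S) :=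
    mapsTo_outerLimit e.symm.continuous fun τ hτ q hq => by simpa [h τ hτ] using hq
  exact fun p hp => by simpa using hsymm hp

theorem innerLimit_eq_preimage (e : X ≃ₜ Y) {S : ℝ → Set X} {T : ℝ → Set Y}
    (h : ∀ τ > 0, S τ = e ⁻¹' T τ) : innerLimit S = e ⁻¹' innerLimit T := by
  refine Set.Subset.antisymm (mapsTo_innerLimit e.continuous fun τ hτ => (h τ hτ).subset) ?_
  have hsymm : Set.MapsTo e.symm (innerLimit T) (innerLimit S) :=
    mapsTo_innerLimit e.symm.continuous fun τ hτ q hq => by simpa [h τ hτ] using hq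
  exact fun p hp => by simpa using hsymm hp

theorem tendsto_nhdsGT_zero_of_forall_pos {f : ℝ → X} {l : X}
    (h : ∀ τ : ℕ → ℝ, (∀ n, 0 < τ n) → Tendsto τ atTop (𝓝 0) → Tendsto (f ∘ τ) atTop (𝓝 l)) :
    Tendsto f (𝓝[>] 0) (𝓝 l) := by
  refine tendsto_of_seq_tendsto fun τ hτ => ?_
  obtain ⟨hτ0, hτpos⟩ := tendsto_nhdsWithin_iff.1 hτ
  obtain ⟨N, hN⟩ := eventually_atTop.1 hτpos
  exact (tendsto_add_atTop_iff_nat N).1 (h (fun n => τ (n + N))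
    (fun n => hN _ (Nat.le_add_left N n)) ((tendsto_add_atTop_iff_nat N).2 hτ0))

end SetLimits

section LipschitzFamilies

variable {X Y : Type*} [PseudoMetricSpace X] {K : NNReal}

theorem tendsto_apply_of_tendsto_apply_of_lipschitzWith [PseudoMetricSpace Y] {ι : Type*}
    {l : Filter ι} {G : ι → X → Y} {u : ι → X} {x : X} {d : Y}
    (hG : ∀ᶠ i in l, LipschitzWith K (G i)) (hu : Tendsto u l (𝓝 x))
    (hd : Tendsto (fun i => G i (u i)) l (𝓝 d)) : Tendsto (fun i => G i x) l (𝓝 d) := by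
  refine tendsto_of_tendsto_of_dist hd ?_
  refine squeeze_zero' (.of_forall fun _ => dist_nonneg)
    (hG.mono fun i hi => hi.dist_le_mul (u i) x) ?_
  simpa using (tendsto_iff_dist_tendsto_zero.1 hu).const_mul (K : ℝ)

theorem mem_innerLimit_graphOn_iff [PseudoMetricSpace Y] {F : ℝ → X → Y}
    (hF : ∀ τ > 0, LipschitzWith K (F τ)) {x : X} {d : Y} :
    (x, d) ∈ innerLimit (fun τ => Set.univ.graphOn (F τ)) ↔
      Tendsto (fun τ => F τ x) (𝓝[>] 0) (𝓝 d) := by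
  constructor
  · refine fun h => tendsto_nhdsGT_zero_of_forall_pos fun τ hτ hτ0 => ?_
    obtain ⟨u, hu, hux⟩ := h τ hτ hτ0
    refine tendsto_apply_of_tendsto_apply_of_lipschitzWith (.of_forall fun n => hF _ (hτ n))
      hux.fst_nhds (hux.snd_nhds.congr' ?_)
    exact hu.mono fun n hn => (Set.mem_graphOn.1 hn).2.symm
  · intro h τ hτ hτ0
    have hτ' : Tendsto τ atTop (𝓝[>] 0) := tendsto_nhdsWithin_iff.2 ⟨hτ0, .of_forall hτ⟩
    exact ⟨fun n => (x, F (τ n) x), .of_forall fun n => by simp,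
      tendsto_const_nhds.prodMk_nhds (h.comp hτ')⟩

theorem eq_of_mem_outerLimit_graphOn [MetricSpace Y] {F : ℝ → X → Y}
    (hF : ∀ τ > 0, LipschitzWith K (F τ)) {x : X} {d d' : Y}
    (hd : (x, d) ∈ outerLimit (fun τ => Set.univ.graphOn (F τ)))
    (hd' : Tendsto (fun τ => F τ x) (𝓝[>] 0) (𝓝 d')) : d = d' := by
  obtain ⟨τ, u, hτ, hτ0, hu, hux⟩ := hd
  have hτ' : Tendsto τ atTop (𝓝[>] 0) := tendsto_nhdsWithin_iff.2 ⟨hτ0, .of_forall hτ⟩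
  refine tendsto_nhds_unique ?_ (hd'.comp hτ')
  exact tendsto_apply_of_tendsto_apply_of_lipschitzWith (.of_forall fun n => hF _ (hτ n))
    hux.fst_nhds (hux.snd_nhds.congr fun n => (Set.mem_graphOn.1 (hu n)).2.symm)

theorem outerLimit_graphOn_eq_innerLimit_and_forall_exists_iff [MetricSpace Y] {F : ℝ → X → Y}
    (hF : ∀ τ > 0, LipschitzWith K (F τ)) :
    (outerLimit (fun τ => Set.univ.graphOn (F τ)) = innerLimit (fun τ => Set.univ.graphOn (F τ)) ∧
        ∀ x, ∃ d, (x, d) ∈ outerLimit (fun τ => Set.univ.graphOn (F τ))) ↔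
      ∀ x, ∃ d, Tendsto (fun τ => F τ x) (𝓝[>] 0) (𝓝 d) := by
  simp only [← mem_innerLimit_graphOn_iff hF]
  constructor
  · rintro ⟨heq, h⟩
    rwa [heq] at h
  · intro h
    have heq : outerLimit (fun τ => Set.univ.graphOn (F τ)) =
        innerLimit (fun τ => Set.univ.graphOn (F τ)) := by
      refine Set.Subset.antisymm ?_ (innerLimit_subset_outerLimit _)
      rintro ⟨x, d⟩ hd
      obtain ⟨d', hd'⟩ := h x
      rwa [eq_of_mem_outerLimit_graphOn hF hd ((mem_innerLimit_graphOn_iff hF).1 hd')]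
    exact ⟨heq, by rwa [heq]⟩

end LipschitzFamilies

section MapDiffQuot

variable {E F : Type*} [NormedAddCommGroup E] [NormedSpace ℝ E] [NormedAddCommGroup F]
  [NormedSpace ℝ F]

/-- The difference quotient `h ↦ (f (y + τ h) - f y) / τ` of a map. -/
noncomputable def mapDiffQuot (f : E → F) (y : E) (τ : ℝ) (h : E) : F :=
  τ⁻¹ • (f (y + τ • h) - f y)

theorem lipschitzWith_mapDiffQuot {f : E → F} {K : NNReal} (hf : LipschitzWith K f) (y : E)
    {τ : ℝ} (hτ : 0 < τ) : LipschitzWith K (mapDiffQuot f y τ) := by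
  refine LipschitzWith.of_dist_le_mul fun h k => ?_
  calc dist (mapDiffQuot f y τ h) (mapDiffQuot f y τ k)
      = τ⁻¹ * dist (f (y + τ • h)) (f (y + τ • k)) := by
        rw [mapDiffQuot, mapDiffQuot, dist_smul₀, dist_sub_right,
          Real.norm_of_nonneg (inv_pos.2 hτ).le]
    _ ≤ τ⁻¹ * (K * dist (y + τ • h) (y + τ • k)) := by
        gcongr
        exact hf.dist_le_mul _ _
    _ = K * dist h k := by
        rw [dist_add_left, dist_smul₀, Real.norm_of_nonneg hτ.le]
        field_simp

end MapDiffQuot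

section MintyHomeomorph

variable {G : Type*} [TopologicalSpace G] [AddGroup G] [IsTopologicalAddGroup G]

variable (G) in
/-- The Minty parametrization `(x, v) ↦ (x + v, x)`, which takes the graph of an operator to the
graph of its resolvent. -/
def mintyHomeomorph : G × G ≃ₜ G × G :=
  (Homeomorph.shearAddRight G).trans (Homeomorph.prodComm G G)

theorem mintyHomeomorph_apply (x v : G) : mintyHomeomorph G (x, v) = (x + v, x) := rfl

end MintyHomeomorph

section ProtoDerivative

variable {H : Type*} [NormedAddCommGroup H] [InnerProductSpace ℝ H] {A B : H → Set H}

theorem IsMonotone.diffQuot (hA : IsMonotone A) (x v : H) {τ : ℝ} (hτ : 0 < τ) :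
    IsMonotone (diffQuot A x v τ) := by
  intro h₁ h₂ k₁ k₂ hk₁ hk₂
  have h := hA _ _ _ _ ((mem_diffQuot_iff hτ.ne').1 hk₁) ((mem_diffQuot_iff hτ.ne').1 hk₂)
  rw [add_sub_add_left_eq_sub, add_sub_add_left_eq_sub, ← smul_sub, ← smul_sub,
    real_inner_smul_left, real_inner_smul_right] at h
  exact nonneg_of_mul_nonneg_right (nonneg_of_mul_nonneg_right h hτ) hτ

theorem isMonotone_of_graph_subset_innerLimit {D : ℝ → H → Set H} (hD : ∀ τ > 0, IsMonotone (D τ))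
    (hA : graph A ⊆ innerLimit fun τ => graph (D τ)) : IsMonotone A := by
  intro x₁ x₂ v₁ v₂ h₁ h₂
  obtain ⟨τ, -, hτ, hτ0⟩ := exists_seq_strictAnti_tendsto (0 : ℝ)
  obtain ⟨u, hu, hux⟩ := hA (show (x₁, v₁) ∈ graph A from h₁) τ hτ hτ0
  obtain ⟨w, hw, hwx⟩ := hA (show (x₂, v₂) ∈ graph A from h₂) τ hτ hτ0
  refine ge_of_tendsto ((hux.snd_nhds.sub hwx.snd_nhds).inner (hux.fst_nhds.sub hwx.fst_nhds)) ?_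
  filter_upwards [hu, hw] with n hun hwn using hD _ (hτ n) _ _ _ _ hun hwn

theorem IsProtoDifferentiableAt.isMonotone_protoDeriv {x v : H}
    (h : IsProtoDifferentiableAt A x v) (hA : IsMonotone A) : IsMonotone (protoDeriv A x v) :=
  isMonotone_of_graph_subset_innerLimit (fun _ hτ => hA.diffQuot x v hτ) h.2.subset

theorem IsMaximallyMonotone.graph_diffQuot_eq_preimage [CompleteSpace H]
    (hB : IsMaximallyMonotone B) (y : H) {τ : ℝ} (hτ : τ ≠ 0) :
    graph (diffQuot B (resolvent B y) (y - resolvent B y) τ) =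
      mintyHomeomorph H ⁻¹' Set.univ.graphOn (mapDiffQuot (resolvent B) y τ) := by
  ext ⟨h, k⟩
  have hsum : resolvent B y + τ • h + (y - resolvent B y + τ • k) = y + τ • (h + k) := by
    rw [smul_add]
    abel
  calc (h, k) ∈ graph (diffQuot B (resolvent B y) (y - resolvent B y) τ)
      ↔ resolvent B (y + τ • (h + k)) = resolvent B y + τ • h := by
        rw [← hsum, ← hB.mem_iff_resolvent_add_eq]
        exact mem_diffQuot_iff hτ
    _ ↔ (h, k) ∈ mintyHomeomorph H ⁻¹' Set.univ.graphOn (mapDiffQuot (resolvent B) y τ) := by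
        rw [Set.mem_preimage, mintyHomeomorph_apply, Set.mem_graphOn, mapDiffQuot,
          inv_smul_eq_iff₀ hτ, sub_eq_iff_eq_add']
        exact (and_iff_right (Set.mem_univ _)).symm

theorem IsMaximallyMonotone.outerLimit_graph_diffQuot_eq_preimage [CompleteSpace H]
    (hB : IsMaximallyMonotone B) (y : H) :
    outerLimit (fun τ => graph (diffQuot B (resolvent B y) (y - resolvent B y) τ)) =
      mintyHomeomorph H ⁻¹'
        outerLimit (fun τ => Set.univ.graphOn (mapDiffQuot (resolvent B) y τ)) :=
  outerLimit_eq_preimage _ fun _ hτ => hB.graph_diffQuot_eq_preimage y hτ.ne'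

theorem IsMaximallyMonotone.isProtoDifferentiableAt_resolvent_iff [CompleteSpace H]
    (hB : IsMaximallyMonotone B) (y : H) :
    IsProtoDifferentiableAt B (resolvent B y) (y - resolvent B y) ↔
      outerLimit (fun τ => Set.univ.graphOn (mapDiffQuot (resolvent B) y τ)) =
        innerLimit (fun τ => Set.univ.graphOn (mapDiffQuot (resolvent B) y τ)) := by
  rw [IsProtoDifferentiableAt, and_iff_right (hB.sub_resolvent_mem y),
    hB.outerLimit_graph_diffQuot_eq_preimage y,
    innerLimit_eq_preimage _ fun _ hτ => hB.graph_diffQuot_eq_preimage y hτ.ne',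
    (mintyHomeomorph H).surjective.preimage_injective.eq_iff]

theorem IsMaximallyMonotone.sub_mem_protoDeriv_resolvent_iff [CompleteSpace H]
    (hB : IsMaximallyMonotone B) (y : H) {z d : H} :
    z - d ∈ protoDeriv B (resolvent B y) (y - resolvent B y) d ↔
      (z, d) ∈ outerLimit (fun τ => Set.univ.graphOn (mapDiffQuot (resolvent B) y τ)) := by
  rw [protoDeriv, Set.mem_ofPred_eq, hB.outerLimit_graph_diffQuot_eq_preimage y, Set.mem_preimage,
    mintyHomeomorph_apply, add_sub_cancel]

end ProtoDerivative

end SetValued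

theorem theorem3p1 {H : Type*} [NormedAddCommGroup H] [InnerProductSpace ℝ H] [CompleteSpace H]
    (B : H → Set H) (hB : SetValued.IsMaximallyMonotone B) :
    (∀ z : H, SetValued.inv (SetValued.idAdd B) z = {SetValued.resolvent B z}) ∧
    ∀ x y : H, x = SetValued.resolvent B y →
      ((SetValued.IsProtoDifferentiableAt B x (y - x) ∧
          SetValued.IsMaximallyMonotone (SetValued.protoDeriv B x (y - x))) ↔
        SetValued.IsDirectionallyDifferentiableAt (SetValued.resolvent B) y) := by
  refine ⟨hB.inv_idAdd_eq_singleton, ?_⟩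
  rintro _ y rfl
  set J := SetValued.resolvent B
  set D := SetValued.protoDeriv B (J y) (y - J y)
  set Γ : ℝ → Set (H × H) := fun τ => Set.univ.graphOn (SetValued.mapDiffQuot J y τ)
  calc SetValued.IsProtoDifferentiableAt B (J y) (y - J y) ∧ SetValued.IsMaximallyMonotone D
      ↔ SetValued.IsProtoDifferentiableAt B (J y) (y - J y) ∧ ∀ z, ∃ d, z - d ∈ D d := by
        rw [SetValued.isMaximallyMonotone_iff_forall_exists_sub_mem]
        exact and_congr_right fun h => and_iff_right (h.isMonotone_protoDeriv hB.prop)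
    _ ↔ SetValued.outerLimit Γ = SetValued.innerLimit Γ ∧
          ∀ z, ∃ d, (z, d) ∈ SetValued.outerLimit Γ :=
        and_congr (hB.isProtoDifferentiableAt_resolvent_iff y) <|
          forall_congr' fun _ => exists_congr fun _ => hB.sub_mem_protoDeriv_resolvent_iff y
    _ ↔ SetValued.IsDirectionallyDifferentiableAt J y :=
        SetValued.outerLimit_graphOn_eq_innerLimit_and_forall_exists_iff fun _ hτ =>
          SetValued.lipschitzWith_mapDiffQuot hB.lipschitzWith_resolvent y hτ
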